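/- Let $\mathbf A\in\mathbb R^{[n]^4}$ be a random order-$4$ tensor of dimension $n$ whose $n^4$ entries are independent, each distributed symmetrically about $0$ and subgaussian with variance proxy $c$, i.e. $\mathbb E\,e^{t\mathbf A_{ijkl}}\le e^{ct^2/2}$ for all $t\in\mathbb R$ (the entries need not be identically distributed). Let $A$ be its natural $n^2\times n^2$ flattening, $A_{(i,j),(k,l)}=\mathbf A_{ijkl}$. For an integer $d\ge 1$ let $A^{\otimes d}$ be its $d$-fold Kronecker power, with rows and columns indexed by $[n]^{2d}$, and let $\mathbb E_{\Pi,\Sigma}[\Pi A^{\otimes d}\Sigma]$ be the average over independent uniformly random $\Pi,\Sigma$ among the $(2d)!$ matrices that permute the $2d$ coordinates of the index set $[n]^{2d}$. Let $\|\cdot\|$ be the Euclidean operator norm. There is an absolute constant $K\in\mathbb N$, and for each $c\ge 0$ a constant $C>0$ depending only on $c$, such that for every sequence $d=d(n)\ge 1$ of integers with $d\log n=o(n)$, and every choice, for each $n$, of a random tensor $\mathbf A$ as above, one has, with probability tending to $1$ as $n\to\infty$, $$\left\|\mathbb E_{\Pi,\Sigma}\left[\Pi A^{\otimes d}\Sigma\right]\right\|^{1/d}\;\le\;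 C(\log n)^K\cdot\frac{n}{d^{1/2}}\cdot d^{\,12\frac{\log d}{\log n}}.$$ -/

import Mathlib

open scoped NNReal BigOperators

noncomputable section

/-- A real order-4 tensor of dimension `n`: one entry for each index tuple in `[n]⁴`. -/
abbrev Tensor4 (n : ℕ) : Type := (Fin 4 → Fin n) → ℝ

/-- The natural `n² × n²` flattening: the row index is the first pair of tensor indices, the
column index is the second pair. -/
def Tensor4.flatten {n : ℕ} (T : Tensor4 n) : Matrix (Fin 2 → Fin n) (Fin 2 → Fin n) ℝ :=
  Matrix.of fun I J => T ![I 0, I 1, J 0, J 1]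

/-- The `2d` positions of an index tuple in `[n]^{2d} = ([n]²)^d`: position `(k, a)` is the `a`-th
slot of the `k`-th pair. -/
abbrev Position (d : ℕ) : Type := Fin d × Fin 2

/-- The `d`-fold Kronecker power of an `n² × n²` matrix, an `n^{2d} × n^{2d}` matrix. -/
def kroneckerPower {n : ℕ} (M : Matrix (Fin 2 → Fin n) (Fin 2 → Fin n) ℝ) (d : ℕ) :
    Matrix (Position d → Fin n) (Position d → Fin n) ℝ :=
  Matrix.of fun I J => ∏ k : Fin d, M (fun a => I (k, a)) (fun a => J (k, a))

/-- The `n^{2d} × n^{2d}` permutation matrix of the action on `[n]^{2d}` of a permutation of the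
`2d` positions. -/
def positionPermMatrix (n : ℕ) {d : ℕ} (π : Equiv.Perm (Position d)) :
    Matrix (Position d → Fin n) (Position d → Fin n) ℝ :=
  Equiv.Perm.permMatrix ℝ (π.arrowCongr (Equiv.refl (Fin n)))

/-- The certificate matrix: the average of `Π A^{⊗ d} Σ` over independent uniformly random
`Π` and `Σ` in the symmetric group on the `2d` positions. -/
def certificateMatrix {n : ℕ} (T : Tensor4 n) (d : ℕ) :
    Matrix (Position d → Fin n) (Position d → Fin n) ℝ :=
  ((Fintype.card (Equiv.Perm (Position d)) : ℝ) ^ 2)⁻¹ •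
    ∑ π : Equiv.Perm (Position d), ∑ σ : Equiv.Perm (Position d),
      positionPermMatrix n π * kroneckerPower T.flatten d * positionPermMatrix n σ

/-- The operator norm of a square real matrix with respect to the Euclidean norm. -/
def euclideanOpNorm {ι : Type*} [Fintype ι] [DecidableEq ι] (M : Matrix ι ι ℝ) : ℝ :=
  ‖Matrix.toEuclideanCLM (𝕜 := ℝ) M‖

end

/-! The proof is a trace moment bound in which path counting is replaced by a potential function.
Truncation at `τ` of order `√(log n)` makes the entries bounded and keeps them independent and
symmetric. With `M` the symmetrized power and `L` a power of two of order `log n`, `‖M‖ ^ (2L)` is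
at most the trace of `(M Mᵀ) ^ L`, whose expectation is a sum over walks of `2L` layers. Each layer
uses `d` entries of the matrix, and a walk contributes only if every entry is used an even number of
times.

The walk is explored one entry at a time. The state consists of the labels `c` still to be drawn on
the left of the layer, the labels `r` already placed on the right, and the set `Λ` of entries used
an odd number of times so far. The total weight of all continuations is bounded by `potential c r Λ
* θ ^ Λ.card` times a factor `ν = (D R)² θ + b / θ` per remaining entry. Adding a new entry to `Λ`
leaves the left double factorials alone and multiplies the right ones by factors that sum to at most
`R²` over the labels. Removing an entry from `Λ` leaves the right side alone, and the drop in the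
left double factorials pays for the number of draws (`draw_mul_doubleFactorialProd_le`). This is
`sum_draw_mul_potential_le`; `sum_perm_potential_le` iterates it over a layer and `integral_walk_le`
over the walk. At the end the potential is at least `1`, so it dominates the indicator of `Λ = ∅`.

With `D = 2d`, `R = 3n`, `b = 2Ld` and the balancing `θ`, `ν` is of order `d n √(L d)`. Each layer
has one average over `(2d)!` permutations, which gains order `d²` per entry and leaves `n √L / √d`.
With the factor `τ` the loss is a single power of `log n`, so `K = 1`; the factor `d ^ (12 log d /
log n)` is at least `1` and is not needed. -/

namespace Tensor4

open scoped Nat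

variable {n : ℕ}

/-! ### Draws from a bag and double factorials. -/

/-- The content of a pair of labels: how often each label occurs in it. -/
def legs (p : Fin 2 → Fin n) : Fin n → ℕ := Pi.single (p 0) 1 + Pi.single (p 1) 1

/-- The number of ways to draw the labels of the pair `p`, one after the other and without
replacement, from a bag with content `c`. -/
def draw (c : Fin n → ℕ) (p : Fin 2 → Fin n) : ℕ :=
  c (p 0) * (c - Pi.single (p 0) 1 : Fin n → ℕ) (p 1)

/-- The product of the double factorials of the entries of `Q`. -/
def doubleFactorialProd (Q : Fin n → ℕ) : ℕ := ∏ i, (Q i)‼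

lemma doubleFactorialProd_pos (Q : Fin n → ℕ) : 0 < doubleFactorialProd Q :=
  Finset.prod_pos fun i _ => Nat.doubleFactorial_pos (Q i)

lemma doubleFactorial_mono : Monotone Nat.doubleFactorial := by
  refine monotone_nat_of_le_succ fun k => ?_
  induction k using Nat.strong_induction_on with
  | _ k ih =>
    match k with
    | 0 => simp [Nat.doubleFactorial]
    | 1 => simp [Nat.doubleFactorial]
    | k + 2 =>
      rw [Nat.doubleFactorial_add_two, show k + 2 + 1 = (k + 1) + 2 from rfl,
        Nat.doubleFactorial_add_two]
      exact Nat.mul_le_mul (by lia) (ih k (by lia))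

lemma doubleFactorialProd_mono {Q Q' : Fin n → ℕ} (h : Q ≤ Q') :
    doubleFactorialProd Q ≤ doubleFactorialProd Q' :=
  Finset.prod_le_prod' fun i _ => doubleFactorial_mono (h i)

lemma doubleFactorialProd_add_single_two (Q : Fin n → ℕ) (j : Fin n) :
    doubleFactorialProd (Q + Pi.single j 2) = (Q j + 2) * doubleFactorialProd Q := by
  unfold doubleFactorialProd
  rw [← Finset.mul_prod_erase _ _ (Finset.mem_univ j),
    ← Finset.mul_prod_erase _ (fun i => (Q i)‼) (Finset.mem_univ j), ← mul_assoc]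
  congr 1
  · simp
  · refine Finset.prod_congr rfl fun i hi => ?_
    simp [Pi.single_eq_of_ne (Finset.ne_of_mem_erase hi)]

lemma add_two_legs (Q : Fin n → ℕ) (p : Fin 2 → Fin n) :
    Q + legs p + legs p = Q + Pi.single (p 0) 2 + Pi.single (p 1) 2 := by
  ext i
  have h (j : Fin n) : (Pi.single j 2 : Fin n → ℕ) i =
      (Pi.single j 1 : Fin n → ℕ) i + (Pi.single j 1 : Fin n → ℕ) i := by
    by_cases hij : i = j
    · subst hij; simp
    · simp [hij]
  simp only [legs, Pi.add_apply, h]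
  ring

lemma sum_pi_single (j : Fin n) (a : ℕ) : ∑ i, (Pi.single j a : Fin n → ℕ) i = a := by
  simp

lemma sum_legs (p : Fin 2 → Fin n) : ∑ i, legs p i = 2 := by
  simp [legs, Finset.sum_add_distrib]

lemma sum_pair (f : Fin n → Fin n → ℕ) :
    ∑ p : Fin 2 → Fin n, f (p 0) (p 1) = ∑ i, ∑ j, f i j := by
  rw [← Fintype.sum_prod_type']
  exact Fintype.sum_equiv (finTwoArrowEquiv (Fin n)) _ _ fun p => rfl

/-- Adding two to the entry at `j` multiplies the product by `Q j + 2`, and these factors sum to `∑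
Q + 2n`; the second label sees a total larger by `2`. -/
lemma sum_doubleFactorialProd_add_two_legs (Q : Fin n → ℕ) :
    ∑ p : Fin 2 → Fin n, doubleFactorialProd (Q + legs p + legs p) ≤
      (∑ i, Q i + 2 * n + 2) ^ 2 * doubleFactorialProd Q := by
  have key (Q : Fin n → ℕ) : ∑ j, doubleFactorialProd (Q + Pi.single j 2) =
      (∑ i, Q i + 2 * n) * doubleFactorialProd Q := by
    simp_rw [doubleFactorialProd_add_single_two, ← Finset.sum_mul, Finset.sum_add_distrib]
    simp [mul_comm]
  simp_rw [add_two_legs]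
  have h := sum_pair fun i j => doubleFactorialProd (Q + Pi.single i 2 + Pi.single j 2)
  rw [h]
  simp_rw [key, Pi.add_apply, Finset.sum_add_distrib, sum_pi_single, ← Finset.mul_sum, key]
  rw [sq, mul_assoc]
  exact Nat.mul_le_mul (by lia) (Nat.mul_le_mul_right _ (by lia))

lemma sum_draw_le (c : Fin n → ℕ) : ∑ p : Fin 2 → Fin n, draw c p ≤ (∑ i, c i) ^ 2 := by
  unfold draw
  have h := sum_pair fun i j => c i * (c - Pi.single i 1 : Fin n → ℕ) j
  rw [h, sq, Finset.sum_mul]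
  refine Finset.sum_le_sum fun i _ => ?_
  rw [← Finset.mul_sum]
  gcongr with j
  simp

/-- A nonzero draw means that the bag contains both labels with multiplicity, so the truncated
subtraction loses nothing. -/
lemma sub_legs_add_legs {c : Fin n → ℕ} {p : Fin 2 → Fin n} (h : draw c p ≠ 0) :
    c - legs p + legs p = c := by
  refine tsub_add_cancel_of_le fun i => ?_
  obtain ⟨h0, h1⟩ := mul_ne_zero_iff.1 h
  simp only [Pi.sub_apply] at h1
  simp only [legs, Pi.add_apply]
  by_cases hi0 : i = p 0 <;> by_cases hi1 : i = p 1
  · have : p 0 = p 1 := hi0 ▸ hi1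
    simp [hi0, this] at h0 h1 ⊢
    lia
  · subst hi0; simp [hi1]; lia
  · subst hi1; simp [hi0] at h1 ⊢; lia
  · simp [hi0, hi1]

lemma draw_add_legs (c : Fin n → ℕ) (p : Fin 2 → Fin n) :
    draw (c + legs p) p = (c (p 0) + 1 + (Pi.single (p 1) 1 : Fin n → ℕ) (p 0)) * (c (p 1) + 1) := by
  have : c + legs p - Pi.single (p 0) 1 = c + Pi.single (p 1) 1 := by
    rw [legs, add_comm (Pi.single (p 0) 1), ← add_assoc, add_tsub_cancel_right]
  rw [draw, this]
  simp [legs]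
  ring

/-- If the draw is possible, passing from left to right raises the argument by two at each drawn
label. The double factorials thus grow by the current entries of the bag plus `Q`, which dominate
the numbers of choices in the draw. -/
lemma draw_mul_doubleFactorialProd_le (c Q : Fin n → ℕ) (p : Fin 2 → Fin n) :
    draw c p * doubleFactorialProd (c - legs p + Q) ≤ doubleFactorialProd (c + (Q + legs p)) := by
  by_cases h : draw c p = 0
  · simp [h]
  obtain ⟨c, rfl⟩ : ∃ c', c = c' + legs p := ⟨c - legs p, (sub_legs_add_legs h).symm⟩
  rw [add_tsub_cancel_right, show c + legs p + (Q + legs p) = c + Q + legs p + legs p by abel,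
    add_two_legs, add_right_comm, doubleFactorialProd_add_single_two,
    doubleFactorialProd_add_single_two, draw_add_legs, ← mul_assoc]
  refine Nat.mul_le_mul_right _ (Nat.mul_le_mul ?_ ?_)
  · have : (Pi.single (p 1) 1 : Fin n → ℕ) (p 0) ≤ (Pi.single (p 1) 2 : Fin n → ℕ) (p 0) := by
      by_cases hp : p 0 = p 1
      · simp [hp]
      · simp [hp]
    simp only [Pi.add_apply]
    lia
  · simp only [Pi.add_apply]
    lia

/-! ### The potential and the exploration of one index pair. -/

/-- The row content of a set of index pairs. -/
def rowLegs (Λ : Finset ((Fin 2 → Fin n) × (Fin 2 → Fin n))) : Fin n → ℕ := ∑ s ∈ Λ, legs s.1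

/-- The column content of a set of index pairs. -/
def colLegs (Λ : Finset ((Fin 2 → Fin n) × (Fin 2 → Fin n))) : Fin n → ℕ := ∑ s ∈ Λ, legs s.2

/-- The potential of the state with remaining left bag `c`, right bag `r` and set `Λ` of index
pairs that have been used an odd number of times. -/
def potential (c r : Fin n → ℕ) (Λ : Finset ((Fin 2 → Fin n) × (Fin 2 → Fin n))) : ℕ :=
  doubleFactorialProd (c + rowLegs Λ) * doubleFactorialProd (r + colLegs Λ)

lemma sum_colLegs (Λ : Finset ((Fin 2 → Fin n) × (Fin 2 → Fin n))) :
    ∑ i, colLegs Λ i = 2 * Λ.card := by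
  simp only [colLegs, Finset.sum_apply]
  rw [Finset.sum_comm]
  simp [sum_legs, mul_comm]

lemma symmDiff_singleton_of_mem {α : Type*} [DecidableEq α] {Λ : Finset α} {s : α} (h : s ∈ Λ) :
    symmDiff Λ {s} = Λ.erase s := by
  ext x
  by_cases hx : x = s <;> simp [Finset.mem_symmDiff, hx, h]

lemma symmDiff_singleton_of_notMem {α : Type*} [DecidableEq α] {Λ : Finset α} {s : α}
    (h : s ∉ Λ) : symmDiff Λ {s} = insert s Λ := by
  ext x
  by_cases hx : x = s <;> simp [Finset.mem_symmDiff, hx, h]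

/-- Closing a pair: on the column side `r` gains the legs that `Λ` loses, while on the row side both
lose them, which absorbs the draw. -/
lemma draw_mul_potential_of_mem (c r : Fin n → ℕ)
    {Λ : Finset ((Fin 2 → Fin n) × (Fin 2 → Fin n))} {s : (Fin 2 → Fin n) × (Fin 2 → Fin n)}
    (h : s ∈ Λ) :
    draw c s.1 * potential (c - legs s.1) (r + legs s.2) (symmDiff Λ {s}) ≤ potential c r Λ := by
  have hr : rowLegs Λ = rowLegs (Λ.erase s) + legs s.1 := (Finset.sum_erase_add _ _ h).symm
  have hc : colLegs Λ = colLegs (Λ.erase s) + legs s.2 := (Finset.sum_erase_add _ _ h).symm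
  rw [symmDiff_singleton_of_mem h, potential, potential, hr, hc, ← mul_assoc,
    show r + legs s.2 + colLegs (Λ.erase s) = r + (colLegs (Λ.erase s) + legs s.2) by abel]
  exact Nat.mul_le_mul_right _ (draw_mul_doubleFactorialProd_le _ _ _)

/-- Opening a pair: on the row side the bag hands its legs over to `Λ`, so nothing changes, while
the column side gains them twice. -/
lemma draw_mul_potential_of_notMem (c r : Fin n → ℕ)
    {Λ : Finset ((Fin 2 → Fin n) × (Fin 2 → Fin n))} {s : (Fin 2 → Fin n) × (Fin 2 → Fin n)}
    (h : s ∉ Λ) :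
    draw c s.1 * potential (c - legs s.1) (r + legs s.2) (symmDiff Λ {s}) =
      doubleFactorialProd (c + rowLegs Λ) * (draw c s.1 *
        doubleFactorialProd (r + colLegs Λ + legs s.2 + legs s.2)) := by
  by_cases h0 : draw c s.1 = 0
  · simp [h0]
  have hr : rowLegs (insert s Λ) = legs s.1 + rowLegs Λ := Finset.sum_insert h
  have hc : colLegs (insert s Λ) = legs s.2 + colLegs Λ := Finset.sum_insert h
  rw [symmDiff_singleton_of_notMem h, potential, hr, hc, ← add_assoc, sub_legs_add_legs h0,
    show r + legs s.2 + (legs s.2 + colLegs Λ) = r + colLegs Λ + legs s.2 + legs s.2 by abel]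
  ring

/-- The potential is a supersolution of the exploration of one index pair. -/
lemma sum_draw_mul_potential_le (c r : Fin n → ℕ)
    (Λ : Finset ((Fin 2 → Fin n) × (Fin 2 → Fin n))) {D R b : ℕ} {θ : ℝ} (hθ : 0 < θ)
    (hc : ∑ i, c i ≤ D) (hr : ∑ i, r i + 2 * Λ.card + 2 * n + 2 ≤ R) (hb : Λ.card ≤ b) :
    ∑ s : (Fin 2 → Fin n) × (Fin 2 → Fin n), (draw c s.1 : ℝ) *
        (potential (c - legs s.1) (r + legs s.2) (symmDiff Λ {s}) *
          θ ^ (symmDiff Λ {s}).card) ≤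
      ((D * R : ℝ) ^ 2 * θ + b / θ) * (potential c r Λ * θ ^ Λ.card) := by
  classical
  -- Pairs outside `Λ` are opened and produce the term with `θ`; the at most `b` pairs inside `Λ`
  -- are closed and cost `1 / θ` each.
  rw [← Finset.sum_compl_add_sum Λ, add_mul]
  refine add_le_add ?_ ?_
  · have h1 : ∑ s ∈ Λᶜ, (draw c s.1 : ℝ) *
        (potential (c - legs s.1) (r + legs s.2) (symmDiff Λ {s}) * θ ^ (symmDiff Λ {s}).card) =
        ((doubleFactorialProd (c + rowLegs Λ) * ∑ s ∈ Λᶜ, (draw c s.1 *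
        doubleFactorialProd (r + colLegs Λ + legs s.2 + legs s.2)) : ℕ) : ℝ) *
          θ ^ (Λ.card + 1) := by
      push_cast
      rw [Finset.mul_sum, Finset.sum_mul]
      refine Finset.sum_congr rfl fun s hs => ?_
      have hs : s ∉ Λ := Finset.mem_compl.1 hs
      rw [← mul_assoc]
      have h2 := draw_mul_potential_of_notMem c r hs
      congr 1
      · exact_mod_cast h2
      · rw [symmDiff_singleton_of_notMem hs, Finset.card_insert_of_notMem hs]
    have h3 : ∑ s ∈ Λᶜ, (draw c s.1 *
        doubleFactorialProd (r + colLegs Λ + legs s.2 + legs s.2)) ≤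
        (D * R) ^ 2 * doubleFactorialProd (r + colLegs Λ) := by
      calc _ ≤ ∑ s : (Fin 2 → Fin n) × (Fin 2 → Fin n), (draw c s.1 *
            doubleFactorialProd (r + colLegs Λ + legs s.2 + legs s.2)) :=
            Finset.sum_le_sum_of_subset (Finset.subset_univ _)
        _ = (∑ p, draw c p) *
            ∑ p, doubleFactorialProd (r + colLegs Λ + legs p + legs p) := by
            rw [Fintype.sum_mul_sum, ← Fintype.sum_prod_type']
        _ ≤ D ^ 2 * (R ^ 2 * doubleFactorialProd (r + colLegs Λ)) := by
            refine Nat.mul_le_mul ((sum_draw_le c).trans (Nat.pow_le_pow_left hc 2)) ?_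
            refine (sum_doubleFactorialProd_add_two_legs _).trans (Nat.mul_le_mul_right _ ?_)
            refine Nat.pow_le_pow_left ?_ 2
            simp only [Pi.add_apply, Finset.sum_add_distrib, sum_colLegs]
            lia
        _ = _ := by ring
    rw [h1]
    calc _ ≤ ((doubleFactorialProd (c + rowLegs Λ) *
          ((D * R) ^ 2 * doubleFactorialProd (r + colLegs Λ)) : ℕ) : ℝ) * θ ^ (Λ.card + 1) := by
          gcongr
      _ = _ := by rw [potential]; push_cast; ring
  · calc _ ≤ ∑ s ∈ Λ, (potential c r Λ * θ ^ Λ.card) / θ := by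
          refine Finset.sum_le_sum fun s hs => ?_
          have hcard : Λ.card = (Λ.erase s).card + 1 := (Finset.card_erase_add_one hs).symm
          rw [← mul_assoc]
          have h2 : ((draw c s.1 * potential (c - legs s.1) (r + legs s.2) (symmDiff Λ {s}) : ℕ)
            : ℝ) ≤ potential c r Λ := by exact_mod_cast draw_mul_potential_of_mem c r hs
          rw [symmDiff_singleton_of_mem hs] at h2 ⊢
          rw [hcard, pow_succ, ← mul_assoc, mul_div_assoc, div_self hθ.ne', mul_one]
          push_cast at h2
          gcongr
      _ = Λ.card / θ * (potential c r Λ * θ ^ Λ.card) := by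
          rw [Finset.sum_const, nsmul_eq_mul]; ring
      _ ≤ _ := by gcongr

/-! ### Parity sets and iteration over a sequence of pairs. -/

/-- The elements that occur an odd number of times in a list. -/
def oddSet {α : Type*} [Fintype α] [DecidableEq α] (l : List α) : Finset α :=
  Finset.univ.filter fun s => Odd (l.count s)

lemma mem_oddSet {α : Type*} [Fintype α] [DecidableEq α] {l : List α} {s : α} :
    s ∈ oddSet l ↔ Odd (l.count s) := by simp [oddSet]

lemma oddSet_perm {α : Type*} [Fintype α] [DecidableEq α] {l l' : List α} (h : l.Perm l') :
    oddSet l = oddSet l' := by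
  ext s; simp [mem_oddSet, h.count_eq s]

lemma oddSet_cons {α : Type*} [Fintype α] [DecidableEq α] (s : α) (l : List α) :
    oddSet (s :: l) = symmDiff (oddSet l) {s} := by
  ext x
  by_cases h : x = s
  · subst h
    simp [mem_oddSet, Finset.mem_symmDiff, Nat.odd_add_one]
  · simp [mem_oddSet, Finset.mem_symmDiff, h, List.count_cons_of_ne (Ne.symm h)]

lemma oddSet_map {α β : Type*} [Fintype α] [DecidableEq α] [Fintype β] [DecidableEq β]
    (e : α ≃ β) (l : List α) : oddSet (l.map e) = (oddSet l).map e.toEmbedding := by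
  ext x
  obtain ⟨x, rfl⟩ := e.surjective x
  simp [mem_oddSet, List.count_map_of_injective l e e.injective]

lemma card_symmDiff_singleton_le {α : Type*} [DecidableEq α] (Λ : Finset α) (s : α) :
    (symmDiff Λ {s}).card ≤ Λ.card + 1 := by
  by_cases h : s ∈ Λ
  · rw [symmDiff_singleton_of_mem h]
    exact (Finset.card_erase_le).trans (Nat.le_succ _)
  · rw [symmDiff_singleton_of_notMem h, Finset.card_insert_of_notMem h]

/-- The number of ways to draw the labels of a sequence of pairs without replacement from a bag
with content `c`. -/
def drawSeq : (m : ℕ) → (Fin n → ℕ) → (Fin m → Fin 2 → Fin n) → ℕ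
  | 0, _, _ => 1
  | m + 1, c, K => draw c (K 0) * drawSeq m (c - legs (K 0)) (Fin.tail K)

lemma potential_mono_left {c c' : Fin n → ℕ} (h : c ≤ c') (r : Fin n → ℕ)
    (Λ : Finset ((Fin 2 → Fin n) × (Fin 2 → Fin n))) : potential c r Λ ≤ potential c' r Λ :=
  Nat.mul_le_mul_right _ (doubleFactorialProd_mono (add_le_add_left h _))

/-- Iteration of `sum_draw_mul_potential_le` over a sequence of index pairs. -/
lemma sum_drawSeq_mul_potential_le {D R b : ℕ} {θ : ℝ} (hθ : 0 < θ) (m : ℕ) :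
    ∀ (c r : Fin n → ℕ) (l : List ((Fin 2 → Fin n) × (Fin 2 → Fin n))), ∑ i, c i ≤ D →
    ∑ i, r i + 2 * (oddSet l).card + 4 * m + 2 * n + 2 ≤ R → (oddSet l).card + m ≤ b →
    ∑ s : Fin m → (Fin 2 → Fin n) × (Fin 2 → Fin n),
      (drawSeq m c (fun k => (s k).1) : ℝ) *
        (potential 0 (r + ∑ k, legs (s k).2) (oddSet (List.ofFn s ++ l)) *
          θ ^ (oddSet (List.ofFn s ++ l)).card) ≤
      ((D * R : ℝ) ^ 2 * θ + b / θ) ^ m * (potential c r (oddSet l) * θ ^ (oddSet l).card) := by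
  induction m with
  | zero =>
    intro c r l _ _ _
    simp only [Finset.univ_unique, Finset.sum_singleton, drawSeq, Finset.univ_eq_empty,
      Finset.sum_empty, add_zero, List.ofFn_zero, List.nil_append, Nat.cast_one, one_mul, pow_zero]
    gcongr
    exact potential_mono_left (fun i => Nat.zero_le _) _ _
  | succ m ih =>
    intro c r l hc hr hb
    rw [← (Fin.consEquiv fun _ => (Fin 2 → Fin n) × (Fin 2 → Fin n)).sum_comp,
      Fintype.sum_prod_type]
    have hstep (s : (Fin 2 → Fin n) × (Fin 2 → Fin n)) :
        ∑ t : Fin m → (Fin 2 → Fin n) × (Fin 2 → Fin n),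
          (drawSeq m (c - legs s.1) (fun k => (t k).1) : ℝ) *
          (potential 0 (r + legs s.2 + ∑ k, legs (t k).2) (oddSet (List.ofFn t ++ (s :: l))) *
            θ ^ (oddSet (List.ofFn t ++ (s :: l))).card) ≤
        ((D * R : ℝ) ^ 2 * θ + b / θ) ^ m *
          (potential (c - legs s.1) (r + legs s.2) (oddSet (s :: l)) *
            θ ^ (oddSet (s :: l)).card) := by
      have hcard := card_symmDiff_singleton_le (oddSet l) s
      refine ih (c - legs s.1) (r + legs s.2) (s :: l) ?_ ?_ ?_
      · exact (Finset.sum_le_sum fun i _ => by simp).trans hc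
      · simp only [Pi.add_apply, Finset.sum_add_distrib, sum_legs, oddSet_cons]
        lia
      · rw [oddSet_cons]
        lia
    calc _ = ∑ s : (Fin 2 → Fin n) × (Fin 2 → Fin n), (draw c s.1 : ℝ) *
        ∑ t : Fin m → (Fin 2 → Fin n) × (Fin 2 → Fin n),
          (drawSeq m (c - legs s.1) (fun k => (t k).1) : ℝ) *
          (potential 0 (r + legs s.2 + ∑ k, legs (t k).2) (oddSet (List.ofFn t ++ (s :: l))) *
            θ ^ (oddSet (List.ofFn t ++ (s :: l))).card) := by
          refine Finset.sum_congr rfl fun s _ => ?_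
          rw [Finset.mul_sum]
          refine Finset.sum_congr rfl fun t _ => ?_
          -- The induction records the new pair next to `l`, the statement has it in front; parities
          -- do not see the order.
          have hperm : oddSet (List.ofFn t ++ (s :: l)) = oddSet (s :: List.ofFn t ++ l) :=
            oddSet_perm List.perm_middle
          have hcons : List.ofFn ((Fin.consEquiv fun _ => (Fin 2 → Fin n) × (Fin 2 → Fin n)) (s, t))
              = s :: List.ofFn t := by
            rw [List.ofFn_succ]; rfl
          have htail : (Fin.tail fun k => (((Fin.consEquiv fun _ =>
              (Fin 2 → Fin n) × (Fin 2 → Fin n)) (s, t)) k).1) = fun k => (t k).1 := rfl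
          rw [hcons, drawSeq, htail, hperm, Fin.sum_univ_succ]
          simp only [Fin.consEquiv_apply, Fin.cons_zero, Fin.cons_succ, Nat.cast_mul, mul_assoc,
            add_assoc, List.cons_append]
      _ ≤ ∑ s : (Fin 2 → Fin n) × (Fin 2 → Fin n), (draw c s.1 : ℝ) *
          (((D * R : ℝ) ^ 2 * θ + b / θ) ^ m *
            (potential (c - legs s.1) (r + legs s.2) (symmDiff (oddSet l) {s}) *
            θ ^ (symmDiff (oddSet l) {s}).card)) := by
          gcongr with s
          simpa only [oddSet_cons] using hstep s
      _ = ((D * R : ℝ) ^ 2 * θ + b / θ) ^ m *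
          ∑ s : (Fin 2 → Fin n) × (Fin 2 → Fin n), (draw c s.1 : ℝ) *
            (potential (c - legs s.1) (r + legs s.2) (symmDiff (oddSet l) {s}) *
            θ ^ (symmDiff (oddSet l) {s}).card) := by
          rw [Finset.mul_sum]
          exact Finset.sum_congr rfl fun s _ => by ring
      _ ≤ ((D * R : ℝ) ^ 2 * θ + b / θ) ^ m * (((D * R : ℝ) ^ 2 * θ + b / θ) *
          (potential c r (oddSet l) * θ ^ (oddSet l).card)) := by
          gcongr
          exact sum_draw_mul_potential_le c r _ hθ hc (by lia) (by lia)
      _ = _ := by ring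

/-! ### From permutation averages to draws, and the bound for one layer. -/

/-- The number of occurrences of each label in a labelling. -/
def content {α : Type*} [Fintype α] (I : α → Fin n) : Fin n → ℕ := fun i =>
  Fintype.card {p // I p = i}

lemma content_eq_sum_legs {d : ℕ} (I : Position d → Fin n) :
    content I = ∑ k, legs (fun a => I (k, a)) := by
  ext i
  simp only [content, Fintype.card_subtype, Finset.card_filter, Fintype.sum_prod_type,
    Finset.sum_apply, legs, Pi.add_apply, Fin.sum_univ_two, Pi.single_apply, eq_comm]

lemma sum_content {d : ℕ} (I : Position d → Fin n) : ∑ i, content I i = 2 * d := by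
  rw [content_eq_sum_legs]
  simp only [Finset.sum_apply]
  rw [Finset.sum_comm]
  simp [sum_legs, mul_comm]

lemma content_comp_perm {α : Type*} [Fintype α] (I : α → Fin n) (π : Equiv.Perm α) :
    content (I ∘ π) = content I := by
  ext i
  exact Fintype.card_congr (π.subtypeEquiv fun a => Iff.rfl)

lemma prod_factorial_add_single (c : Fin n → ℕ) (j : Fin n) :
    ∏ i, ((c + Pi.single j 1 : Fin n → ℕ) i)! = (c j + 1) * ∏ i, (c i)! := by
  rw [← Finset.mul_prod_erase _ _ (Finset.mem_univ j),
    ← Finset.mul_prod_erase _ (fun i => (c i)!) (Finset.mem_univ j), ← mul_assoc]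
  congr 1
  · simp [Nat.factorial_succ]
  · refine Finset.prod_congr rfl fun i hi => ?_
    simp [Pi.single_eq_of_ne (Finset.ne_of_mem_erase hi)]

/-- The sequence empties the bag, so the numbers of choices multiply to the order of the stabilizer
of the labelling. -/
lemma drawSeq_sum_legs (m : ℕ) (K : Fin m → Fin 2 → Fin n) :
    drawSeq m (∑ k, legs (K k)) K = ∏ i, ((∑ k, legs (K k)) i)! := by
  induction m with
  | zero => simp [drawSeq]
  | succ m ih =>
    have h : ∑ k, legs (K k) = (∑ k, legs (Fin.tail K k)) + legs (K 0) := by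
      rw [Fin.sum_univ_succ, add_comm]; rfl
    rw [drawSeq, h, add_tsub_cancel_right, ih, draw_add_legs]
    generalize ∑ k, legs (Fin.tail K k) = c
    rw [legs, add_comm (Pi.single (K 0 0) 1), ← add_assoc, prod_factorial_add_single,
      prod_factorial_add_single, Pi.add_apply]
    ring

/-- The set of such `π` is empty or a coset of the stabilizer of `K`. This turns the average over
permutations into sequential drawing without replacement. -/
lemma card_perm_comp_eq_le {d : ℕ} (I K : Position d → Fin n) :
    (Finset.univ.filter fun π : Equiv.Perm (Position d) => I ∘ π = K).card ≤
      drawSeq d (content I) (fun k a => K (k, a)) := by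
  by_cases h : ∃ π : Equiv.Perm (Position d), I ∘ π = K
  · obtain ⟨π₀, rfl⟩ := h
    rw [← content_comp_perm I π₀, content_eq_sum_legs,
      drawSeq_sum_legs d (fun k a => (I ∘ π₀) (k, a)), ← content_eq_sum_legs]
    have h1 := DomMulAct.stabilizer_card (I ∘ π₀)
    simp only [content]
    rw [← h1, Fintype.card_subtype]
    refine Finset.card_le_card_of_injOn (fun π => π₀⁻¹ * π) (fun π hπ => ?_)
      fun π _ π' _ h => mul_left_cancel h
    simp only [Finset.coe_filter, Finset.mem_univ, true_and, Set.mem_ofPred_eq] at hπ ⊢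
    funext p
    simpa using congrFun hπ p
  · rw [Finset.card_eq_zero.2]
    · exact Nat.zero_le _
    · exact Finset.filter_eq_empty_iff.2 fun π _ hπ => h ⟨π, hπ⟩

/-- The index pairs read off from two labellings of the positions. -/
def pairs {d : ℕ} (K J : Position d → Fin n) : Fin d → (Fin 2 → Fin n) × (Fin 2 → Fin n) :=
  fun k => (fun a => K (k, a), fun a => J (k, a))

/-- Lets the right bag of one layer serve as the left bag of the next, where the matrix is
transposed. -/
lemma potential_map_swap (c r : Fin n → ℕ) (Λ : Finset ((Fin 2 → Fin n) × (Fin 2 → Fin n))) :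
    potential c r (Λ.map (Equiv.prodComm _ _).toEmbedding) = potential r c Λ := by
  simp [potential, rowLegs, colLegs, mul_comm]

lemma sum_perm_le {d : ℕ} (I : Position d → Fin n) {f : (Position d → Fin n) → ℝ} (hf : 0 ≤ f) :
    ∑ π : Equiv.Perm (Position d), f (I ∘ π) ≤
      ∑ K, (drawSeq d (content I) (fun k a => K (k, a)) : ℝ) * f K := by
  rw [← Finset.sum_fiberwise (s := Finset.univ) (g := fun π : Equiv.Perm (Position d) => I ∘ π)]
  refine Finset.sum_le_sum fun K _ => ?_
  rw [Finset.sum_congr rfl (g := fun _ => f K)]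
  · rw [Finset.sum_const, nsmul_eq_mul]
    exact mul_le_mul_of_nonneg_right (by exact_mod_cast card_perm_comp_eq_le I K) (hf K)
  · intro π hπ
    rw [(Finset.mem_filter.1 hπ).2]

/-- The potential is a supersolution of the exploration of one layer. -/
lemma sum_perm_potential_le {d b R : ℕ} {θ : ℝ} (hθ : 0 < θ)
    (l : List ((Fin 2 → Fin n) × (Fin 2 → Fin n))) (hb : (oddSet l).card + d ≤ b)
    (hR : 4 * b + 2 * n + 2 ≤ R) (I : Position d → Fin n) :
    ∑ π : Equiv.Perm (Position d), ∑ J : Position d → Fin n,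
      (potential 0 (content J) (oddSet (List.ofFn (pairs (I ∘ π) J) ++ l)) : ℝ) *
        θ ^ (oddSet (List.ofFn (pairs (I ∘ π) J) ++ l)).card ≤
      (((2 * d) * R : ℝ) ^ 2 * θ + b / θ) ^ d *
        (potential (content I) 0 (oddSet l) * θ ^ (oddSet l).card) := by
  have h := sum_drawSeq_mul_potential_le (n := n) (D := 2 * d) (R := R) (b := b) hθ d (content I) 0
    l (sum_content I).le (by simp only [Pi.zero_apply, Finset.sum_const_zero]; lia) hb
  push_cast at h
  refine le_trans ?_ h
  refine (sum_perm_le I (f := fun K => ∑ J : Position d → Fin n,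
      (potential 0 (content J) (oddSet (List.ofFn (pairs K J) ++ l)) : ℝ) *
        θ ^ (oddSet (List.ofFn (pairs K J) ++ l)).card) fun K => ?_).trans_eq ?_
  · exact Finset.sum_nonneg fun J _ => by positivity
  · simp_rw [Finset.mul_sum]
    rw [← Fintype.sum_prod_type']
    refine Fintype.sum_equiv (((Equiv.curry _ _ _).prodCongr (Equiv.curry _ _ _)).trans
      (Equiv.arrowProdEquivProdArrow _ _ _).symm) _ _ fun x => ?_
    rw [zero_add, content_eq_sum_legs x.2]
    rfl

end Tensor4

namespace Tensor4

open scoped Nat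
open MeasureTheory Matrix

variable {n d : ℕ}

/-! ### Symmetrized Kronecker powers, walks and traces. -/

/-- The average of `Π B^{⊗ d} Σ` over the permutations of the positions, entrywise. -/
noncomputable def symPow (B : Matrix (Fin 2 → Fin n) (Fin 2 → Fin n) ℝ) (d : ℕ) :
    Matrix (Position d → Fin n) (Position d → Fin n) ℝ :=
  Matrix.of fun I J => ((Fintype.card (Equiv.Perm (Position d)) : ℝ) ^ 2)⁻¹ *
    ∑ π : Equiv.Perm (Position d), ∑ σ : Equiv.Perm (Position d),
      kroneckerPower B d (I ∘ π) (J ∘ σ)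

lemma certificateMatrix_eq_symPow (T : Tensor4 n) (d : ℕ) :
    certificateMatrix T d = symPow T.flatten d := by
  ext I J
  simp only [certificateMatrix, symPow, Matrix.smul_apply, Matrix.sum_apply, smul_eq_mul,
    Matrix.of_apply]
  congr 1
  -- Left multiplication by the permutation matrix moves rows by the inverse permutation, hence the
  -- reindexing of `π` alone.
  refine Fintype.sum_equiv (Equiv.inv _) _ _ fun π => Finset.sum_congr rfl fun σ _ => ?_
  simp only [positionPermMatrix, Equiv.Perm.permMatrix, PEquiv.mul_toMatrix_toPEquiv,
    PEquiv.toMatrix_toPEquiv_mul, Matrix.submatrix_apply, id]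
  rfl

lemma symPow_transpose (B : Matrix (Fin 2 → Fin n) (Fin 2 → Fin n) ℝ) (d : ℕ) :
    symPow Bᵀ d = (symPow B d)ᵀ := by
  ext I J
  simp only [symPow, Matrix.transpose_apply, Matrix.of_apply]
  rw [Finset.sum_comm]
  rfl

lemma sum_comp_perm (f : (Position d → Fin n) → ℝ) (σ : Equiv.Perm (Position d)) :
    ∑ J, f (J ∘ σ) = ∑ J, f J :=
  Fintype.sum_equiv (Equiv.arrowCongr σ.symm (Equiv.refl _)) _ _ fun _ => rfl

lemma symPow_mulVec_apply (B : Matrix (Fin 2 → Fin n) (Fin 2 → Fin n) ℝ)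
    (u : (Position d → Fin n) → ℝ) (I : Position d → Fin n) :
    (symPow B d *ᵥ u) I = ((Fintype.card (Equiv.Perm (Position d)) : ℝ))⁻¹ *
      ∑ π : Equiv.Perm (Position d), ∑ J, kroneckerPower B d (I ∘ π) J *
        ((Fintype.card (Equiv.Perm (Position d)) : ℝ)⁻¹ *
          ∑ σ : Equiv.Perm (Position d), u (J ∘ σ)) := by
  have h (π : Equiv.Perm (Position d)) :
      ∑ J, kroneckerPower B d (I ∘ π) J * ∑ σ : Equiv.Perm (Position d), u (J ∘ σ) =
      ∑ J, (∑ σ : Equiv.Perm (Position d), kroneckerPower B d (I ∘ π) (J ∘ σ)) * u J := by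
    simp_rw [Finset.mul_sum, Finset.sum_mul]
    rw [Finset.sum_comm]
    conv_rhs => rw [Finset.sum_comm]
    refine Fintype.sum_equiv (Equiv.inv (Equiv.Perm (Position d))) _ _ fun σ => ?_
    refine Eq.trans (Finset.sum_congr rfl fun J _ => ?_)
      (sum_comp_perm (fun J => kroneckerPower B d (I ∘ π) (J ∘ ⇑(σ⁻¹)) * u J) σ)
    congr 2
    funext p
    simp
  simp only [Matrix.mulVec, dotProduct, symPow, Matrix.of_apply]
  simp_rw [mul_left_comm _ (Fintype.card (Equiv.Perm (Position d)) : ℝ)⁻¹, ← Finset.mul_sum, h,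
    ← mul_assoc, mul_assoc _ (∑ π, _), ← Finset.mul_sum]
  rw [sq, mul_inv]
  congr 1
  simp_rw [Finset.sum_mul]
  rw [Finset.sum_comm]

/-- The average of a vector over the permutations of the positions. -/
noncomputable def symVec (u : (Position d → Fin n) → ℝ) : (Position d → Fin n) → ℝ := fun J =>
  (Fintype.card (Equiv.Perm (Position d)) : ℝ)⁻¹ * ∑ σ : Equiv.Perm (Position d), u (J ∘ σ)

lemma symVec_comp (u : (Position d → Fin n) → ℝ) (τ : Equiv.Perm (Position d))
    (J : Position d → Fin n) : symVec u (J ∘ τ) = symVec u J := by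
  unfold symVec
  congr 1
  exact Fintype.sum_equiv (Equiv.mulLeft τ) _ _ fun σ => rfl

lemma symVec_eq_self {u : (Position d → Fin n) → ℝ}
    (hu : ∀ (τ : Equiv.Perm (Position d)) J, u (J ∘ τ) = u J) : symVec u = u := by
  ext J
  simp only [symVec, hu, Finset.sum_const, Finset.card_univ, nsmul_eq_mul]
  rw [inv_mul_cancel_left₀]
  exact_mod_cast Fintype.card_ne_zero

lemma symPow_mulVec_symVec (B : Matrix (Fin 2 → Fin n) (Fin 2 → Fin n) ℝ)
    (u : (Position d → Fin n) → ℝ) : symPow B d *ᵥ symVec u = symPow B d *ᵥ u := by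
  ext I
  rw [symPow_mulVec_apply, symPow_mulVec_apply]
  have h := symVec_eq_self (symVec_comp u)
  have h2 (J) := congrFun h J
  simp only [symVec] at h2 ⊢
  simp only [h2]

lemma symPow_mulVec_comp (B : Matrix (Fin 2 → Fin n) (Fin 2 → Fin n) ℝ)
    (u : (Position d → Fin n) → ℝ) (τ : Equiv.Perm (Position d)) (I : Position d → Fin n) :
    (symPow B d *ᵥ u) (I ∘ τ) = (symPow B d *ᵥ u) I := by
  rw [symPow_mulVec_apply, symPow_mulVec_apply]
  congr 1
  exact Fintype.sum_equiv (Equiv.mulLeft τ) _ _ fun σ => rfl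

/-- The vector obtained from `w` by applying alternately the symmetrized Kronecker powers of `B`
and of its transpose, `t` times in all; the last one applied is that of `B`. -/
noncomputable def walk (w : (Position d → Fin n) → ℝ) :
    ℕ → Matrix (Fin 2 → Fin n) (Fin 2 → Fin n) ℝ → (Position d → Fin n) → ℝ
  | 0, _ => w
  | t + 1, B => symPow B d *ᵥ walk w t Bᵀ

lemma walk_comp {w : (Position d → Fin n) → ℝ}
    (hw : ∀ (τ : Equiv.Perm (Position d)) J, w (J ∘ τ) = w J) (t : ℕ)
    (B : Matrix (Fin 2 → Fin n) (Fin 2 → Fin n) ℝ) (τ : Equiv.Perm (Position d))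
    (J : Position d → Fin n) : walk w t B (J ∘ τ) = walk w t B J := by
  cases t with
  | zero => exact hw τ J
  | succ t => exact symPow_mulVec_comp B _ τ J

/-- On invariant vectors the average over `σ` is trivial, so each layer keeps one average and one
factor `1 / (2d)!`. -/
lemma walk_succ_apply {w : (Position d → Fin n) → ℝ}
    (hw : ∀ (τ : Equiv.Perm (Position d)) J, w (J ∘ τ) = w J) (t : ℕ)
    (B : Matrix (Fin 2 → Fin n) (Fin 2 → Fin n) ℝ) (I : Position d → Fin n) :
    walk w (t + 1) B I = ((Fintype.card (Equiv.Perm (Position d)) : ℝ))⁻¹ *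
      ∑ π : Equiv.Perm (Position d), ∑ J, kroneckerPower B d (I ∘ π) J * walk w t Bᵀ J := by
  rw [walk, symPow_mulVec_apply]
  congr 1
  refine Finset.sum_congr rfl fun π _ => Finset.sum_congr rfl fun J _ => ?_
  congr 1
  exact congrFun (symVec_eq_self (walk_comp hw t Bᵀ)) J

lemma walk_two_mul (w : (Position d → Fin n) → ℝ) (k : ℕ)
    (B : Matrix (Fin 2 → Fin n) (Fin 2 → Fin n) ℝ) :
    walk w (2 * k) B = (symPow B d * (symPow B d)ᵀ) ^ k *ᵥ w := by
  induction k with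
  | zero => simp [walk]
  | succ k ih =>
    rw [Nat.mul_succ, walk, walk, Matrix.transpose_transpose, ih, symPow_transpose,
      Matrix.mulVec_mulVec, Matrix.mulVec_mulVec, pow_succ', Matrix.mul_assoc]

/-- The rightmost symmetrized power absorbs the averaging of the basis vector, so the walks may
start from an invariant vector. -/
lemma trace_pow_eq_sum_walk (k : ℕ) (B : Matrix (Fin 2 → Fin n) (Fin 2 → Fin n) ℝ) :
    ((symPow B d * (symPow B d)ᵀ) ^ (k + 1)).trace =
      ∑ I : Position d → Fin n, walk (symVec (Pi.single I 1)) (2 * (k + 1)) B I := by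
  refine Finset.sum_congr rfl fun I _ => ?_
  rw [walk_two_mul, pow_succ, ← Matrix.mul_assoc, ← Matrix.mulVec_mulVec, ← symPow_transpose,
    symPow_mulVec_symVec, Matrix.mulVec_mulVec, Matrix.mulVec_single_one]
  rfl

lemma euclideanOpNorm_sq_le {ι : Type*} [Fintype ι] [DecidableEq ι] (N : Matrix ι ι ℝ) :
    euclideanOpNorm N ^ 2 ≤ (N * Nᵀ).trace := by
  have h0 : (N * Nᵀ).trace = ∑ i, ∑ j, N i j ^ 2 := by
    simp [Matrix.trace, Matrix.mul_apply, sq]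
  have hnn : 0 ≤ ∑ i, ∑ j, N i j ^ 2 := by positivity
  have h : euclideanOpNorm N ≤ √(∑ i, ∑ j, N i j ^ 2) := by
    refine ContinuousLinearMap.opNorm_le_bound _ (Real.sqrt_nonneg _) fun v => ?_
    rw [EuclideanSpace.norm_eq, EuclideanSpace.norm_eq, ← Real.sqrt_mul hnn]
    refine Real.sqrt_le_sqrt ?_
    rw [Finset.sum_mul]
    refine Finset.sum_le_sum fun i _ => ?_
    simp only [Real.norm_eq_abs, sq_abs]
    exact Finset.sum_mul_sq_le_sq_mul_sq Finset.univ (fun j => N i j) (fun j => v j)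
  rw [h0, ← Real.sq_sqrt hnn]
  exact pow_le_pow_left₀ (norm_nonneg _) h 2

-- The C*-identity gives exact norms for powers of two of the self-adjoint `M Mᵀ`; the last squaring
-- bounds the operator norm by the Frobenius norm.
open scoped Matrix.Norms.L2Operator in
lemma euclideanOpNorm_pow_le_trace {ι : Type*} [Fintype ι] [DecidableEq ι] (M : Matrix ι ι ℝ)
    (r : ℕ) : euclideanOpNorm M ^ (2 * 2 ^ (r + 1)) ≤ ((M * Mᵀ) ^ (2 ^ (r + 1))).trace := by
  have hstar : star M = Mᵀ := by
    ext i j; simp [Matrix.star_apply]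
  have hnorm (N : Matrix ι ι ℝ) : euclideanOpNorm N = ‖N‖ := rfl
  have h1 : euclideanOpNorm (M * Mᵀ) = euclideanOpNorm M ^ 2 := by
    rw [hnorm, hnorm, ← hstar, CStarRing.norm_self_mul_star, sq]
  have hsa : IsSelfAdjoint (M * Mᵀ) := by
    rw [← hstar]
    exact IsSelfAdjoint.mul_star_self M
  have h2 : euclideanOpNorm ((M * Mᵀ) ^ (2 ^ r)) = euclideanOpNorm (M * Mᵀ) ^ (2 ^ r) := by
    simpa [hnorm] using congrArg NNReal.toReal (hsa.nnnorm_pow_two_pow r)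
  have h3 : ((M * Mᵀ) ^ (2 ^ r))ᵀ = (M * Mᵀ) ^ (2 ^ r) := by
    rw [Matrix.transpose_pow, Matrix.transpose_mul, Matrix.transpose_transpose]
  calc _ = euclideanOpNorm ((M * Mᵀ) ^ (2 ^ r)) ^ 2 := by
        rw [h2, h1, ← pow_mul, ← pow_mul, pow_succ]
    _ ≤ _ := euclideanOpNorm_sq_le _
    _ = _ := by rw [h3, ← pow_add, pow_succ, mul_two]

lemma card_oddSet_append_le {α : Type*} [Fintype α] [DecidableEq α] (s l : List α) :
    (oddSet (s ++ l)).card ≤ (oddSet l).card + s.length := by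
  induction s with
  | nil => simp
  | cons a s ih =>
    rw [List.cons_append, oddSet_cons, List.length_cons]
    exact (card_symmDiff_singleton_le _ _).trans (by lia)

lemma potential_pos (c r : Fin n → ℕ) (Λ : Finset ((Fin 2 → Fin n) × (Fin 2 → Fin n))) :
    0 < potential c r Λ :=
  Nat.mul_pos (doubleFactorialProd_pos _) (doubleFactorialProd_pos _)

/-! ### Expected walks and expected traces. -/

/-- Moment bound for walks: the mixed moments of the matrix entries vanish unless every entry
occurs an even number of times, and are then at most `τ` to the power of the degree. -/
lemma integral_walk_le {Ω : Type*} [MeasurableSpace Ω] {μ : Measure Ω} {τ θ : ℝ} (hτ : 0 ≤ τ)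
    (hθ : 0 < θ) {b R : ℕ} (hR : 4 * b + 2 * n + 2 ≤ R) {w : (Position d → Fin n) → ℝ}
    (hw : ∀ (σ : Equiv.Perm (Position d)) J, w (J ∘ σ) = w J) (hw0 : ∀ J, 0 ≤ w J)
    (hw1 : ∀ J, w J ≤ 1) (t : ℕ) :
    ∀ B : Ω → Matrix (Fin 2 → Fin n) (Fin 2 → Fin n) ℝ,
    (∀ l : List ((Fin 2 → Fin n) × (Fin 2 → Fin n)),
      Integrable (fun ω => (l.map fun s => B ω s.1 s.2).prod) μ ∧
      ∫ ω, (l.map fun s => B ω s.1 s.2).prod ∂μ ≤ if oddSet l = ∅ then τ ^ l.length else 0) →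
    ∀ l : List ((Fin 2 → Fin n) × (Fin 2 → Fin n)), (oddSet l).card + t * d ≤ b →
    ∀ I : Position d → Fin n,
      Integrable (fun ω => (l.map fun s => B ω s.1 s.2).prod * walk w t (B ω) I) μ ∧
      ∫ ω, (l.map fun s => B ω s.1 s.2).prod * walk w t (B ω) I ∂μ ≤
        τ ^ (l.length + t * d) * ((Fintype.card (Equiv.Perm (Position d)) : ℝ)⁻¹ *
          (((2 * d) * R : ℝ) ^ 2 * θ + b / θ) ^ d) ^ t *
        (potential (content I) 0 (oddSet l) * θ ^ (oddSet l).card) := by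
  induction t with
  | zero =>
    intro B hB l _ I
    refine ⟨(hB l).1.mul_const _, ?_⟩
    have hpos : (1 : ℝ) ≤ potential (content I) 0 (oddSet l) := by
      exact_mod_cast potential_pos _ _ _
    simp only [walk, integral_mul_const, zero_mul, add_zero, pow_zero, mul_one]
    -- The endpoint weight is bounded by `1`: the constraint that the walk closes up is given away.
    refine (mul_le_mul_of_nonneg_right (hB l).2 (hw0 I)).trans ?_
    split_ifs with h
    · rw [h] at hpos ⊢
      simp only [Finset.card_empty, pow_zero, mul_one]
      gcongr
      exact (hw1 I).trans hpos
    · rw [zero_mul]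
      positivity
  | succ t ih =>
    intro B hB l hl I
    set L : Equiv.Perm (Position d) → (Position d → Fin n) →
        List ((Fin 2 → Fin n) × (Fin 2 → Fin n)) :=
      fun π J => List.ofFn (pairs (I ∘ π) J) ++ l with hL
    have hBt (l : List ((Fin 2 → Fin n) × (Fin 2 → Fin n))) (ω : Ω) :
        ((l.map (Equiv.prodComm _ _)).map fun s => (B ω)ᵀ s.1 s.2).prod =
          (l.map fun s => B ω s.1 s.2).prod := by
      rw [List.map_map]; rfl
    have hodd (l : List ((Fin 2 → Fin n) × (Fin 2 → Fin n))) :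
        oddSet (l.map (Equiv.prodComm _ _)) = (oddSet l).map (Equiv.prodComm _ _).toEmbedding :=
      oddSet_map _ l
    -- The `d` entries of the exposed layer join the list `l`. The induction hypothesis is applied
    -- to the transpose, so all pairs are swapped; the moment hypothesis is stable under this.
    have hstep (π : Equiv.Perm (Position d)) (J : Position d → Fin n) :=
      ih (fun ω => (B ω)ᵀ) (fun l => by
        obtain ⟨l, rfl⟩ : ∃ l', l = l'.map (Equiv.prodComm _ _) :=
          ⟨l.map (Equiv.prodComm _ _), by simp [List.map_map, Function.comp_def]⟩
        simp only [hBt, hodd, Finset.map_eq_empty, List.length_map]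
        exact hB l) ((L π J).map (Equiv.prodComm _ _)) (by
          rw [hodd, Finset.card_map]
          have := card_oddSet_append_le (List.ofFn (pairs (I ∘ π) J)) l
          rw [List.length_ofFn] at this
          rw [Nat.succ_mul] at hl
          lia) J
    simp only [hBt, hodd, Finset.card_map, potential_map_swap, List.length_map] at hstep
    have hlen (π J) : (L π J).length + t * d = l.length + (t + 1) * d := by
      simp only [hL, List.length_append, List.length_ofFn]; ring
    simp only [hlen] at hstep
    have hexp (ω : Ω) : (l.map fun s => B ω s.1 s.2).prod * walk w (t + 1) (B ω) I =
        ((Fintype.card (Equiv.Perm (Position d)) : ℝ))⁻¹ * ∑ π : Equiv.Perm (Position d), ∑ J,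
          ((L π J).map fun s => B ω s.1 s.2).prod * walk w t (B ω)ᵀ J := by
      rw [walk_succ_apply hw, mul_left_comm, Finset.mul_sum]
      congr 1
      refine Finset.sum_congr rfl fun π _ => ?_
      rw [Finset.mul_sum]
      refine Finset.sum_congr rfl fun J _ => ?_
      rw [← mul_assoc]
      congr 1
      rw [hL, List.map_append, List.prod_append, List.map_ofFn, List.prod_ofFn, mul_comm]
      rfl
    simp only [hexp]
    refine ⟨(integrable_finsetSum _ fun π _ => integrable_finsetSum _ fun J _ =>
      (hstep π J).1).const_mul _, ?_⟩
    rw [integral_const_mul, integral_finsetSum _ fun π _ => integrable_finsetSum _ fun J _ =>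
      (hstep π J).1]
    calc _ ≤ ((Fintype.card (Equiv.Perm (Position d)) : ℝ))⁻¹ *
          ∑ π : Equiv.Perm (Position d), ∑ J, τ ^ (l.length + (t + 1) * d) *
          ((Fintype.card (Equiv.Perm (Position d)) : ℝ)⁻¹ *
          (((2 * d) * R : ℝ) ^ 2 * θ + b / θ) ^ d) ^ t *
            (potential 0 (content J) (oddSet (L π J)) * θ ^ (oddSet (L π J)).card) := by
          gcongr with π
          rw [integral_finsetSum _ fun J _ => (hstep π J).1]
          gcongr with J
          exact (hstep π J).2
      _ = τ ^ (l.length + (t + 1) * d) *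
          ((Fintype.card (Equiv.Perm (Position d)) : ℝ)⁻¹ *
          (((2 * d) * R : ℝ) ^ 2 * θ + b / θ) ^ d) ^ t *
          (((Fintype.card (Equiv.Perm (Position d)) : ℝ))⁻¹ *
          ∑ π : Equiv.Perm (Position d), ∑ J,
            (potential 0 (content J) (oddSet (L π J)) : ℝ) * θ ^ (oddSet (L π J)).card) := by
          simp_rw [← Finset.mul_sum]; ring
      _ ≤ τ ^ (l.length + (t + 1) * d) *
          ((Fintype.card (Equiv.Perm (Position d)) : ℝ)⁻¹ *
          (((2 * d) * R : ℝ) ^ 2 * θ + b / θ) ^ d) ^ t *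
          (((Fintype.card (Equiv.Perm (Position d)) : ℝ))⁻¹ *
          ((((2 * d) * R : ℝ) ^ 2 * θ + b / θ) ^ d *
            (potential (content I) 0 (oddSet l) * θ ^ (oddSet l).card))) := by
          gcongr
          refine sum_perm_potential_le hθ l ?_ hR I
          rw [Nat.succ_mul] at hl
          lia
      _ = _ := by rw [pow_succ]; ring

end Tensor4

namespace Tensor4

open scoped Nat
open MeasureTheory Matrix ProbabilityTheory

variable {n d : ℕ}

lemma integral_pow_eq_zero_of_identDistrib_neg {Ω : Type*} [MeasurableSpace Ω] {μ : Measure Ω}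
    {X : Ω → ℝ} (h : IdentDistrib X (fun ω => -X ω) μ μ) {k : ℕ} (hk : Odd k) :
    ∫ ω, X ω ^ k ∂μ = 0 := by
  have h1 : ∫ ω, X ω ^ k ∂μ = ∫ ω, (-X ω) ^ k ∂μ :=
    (h.comp (measurable_id.pow_const k)).integral_eq
  simp only [hk.neg_pow, integral_neg] at h1
  linarith

lemma list_prod_map_eq_prod_pow_count {ι : Type*} [Fintype ι] [DecidableEq ι] (l : List ι)
    (f : ι → ℝ) : (l.map f).prod = ∏ s, f s ^ l.count s := by
  rw [Finset.prod_list_map_count]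
  refine Finset.prod_subset (Finset.subset_univ _) fun s _ hs => ?_
  rw [List.count_eq_zero_of_not_mem (by simpa using hs), pow_zero]

/-- Mixed moments of independent bounded symmetric random variables. -/
lemma integral_list_prod_le {Ω ι : Type*} [MeasurableSpace Ω] {μ : Measure Ω}
    [IsProbabilityMeasure μ] [Fintype ι] [DecidableEq ι] {X : ι → Ω → ℝ} {τ : ℝ}
    (hind : iIndepFun X μ) (hsymm : ∀ s, IdentDistrib (X s) (fun ω => -X s ω) μ μ)
    (hb : ∀ s ω, |X s ω| ≤ τ) (l : List ι) :
    Integrable (fun ω => (l.map fun s => X s ω).prod) μ ∧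
      ∫ ω, (l.map fun s => X s ω).prod ∂μ ≤ if oddSet l = ∅ then τ ^ l.length else 0 := by
  have hmeas (s) : AEMeasurable (X s) μ := (hsymm s).aemeasurable_fst
  have hbound (l : List ι) (ω : Ω) : |(l.map fun s => X s ω).prod| ≤ τ ^ l.length := by
    induction l with
    | nil => simp
    | cons a l ih =>
      rw [List.map_cons, List.prod_cons, abs_mul, List.length_cons, pow_succ']
      exact mul_le_mul (hb a ω) ih (abs_nonneg _) ((abs_nonneg _).trans (hb a ω))
  have hint : Integrable (fun ω => (l.map fun s => X s ω).prod) μ := by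
    refine Integrable.of_bound ?_ (τ ^ l.length) (Filter.Eventually.of_forall fun ω => hbound l ω)
    simp_rw [list_prod_map_eq_prod_pow_count]
    exact (Finset.aemeasurable_fun_prod _ fun s _ =>
      (hmeas s).pow_const _).aestronglyMeasurable
  refine ⟨hint, ?_⟩
  split_ifs with h
  · calc _ ≤ ∫ _, τ ^ l.length ∂μ :=
          integral_mono hint (integrable_const _) fun ω => (le_abs_self _).trans (hbound l ω)
      _ = _ := by simp
  · obtain ⟨s, hs⟩ := Finset.nonempty_iff_ne_empty.2 h
    simp_rw [list_prod_map_eq_prod_pow_count]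
    rw [hind.integral_fun_prod_comp (f := fun s x => x ^ l.count s) hmeas
      fun s => (measurable_id.pow_const _).aestronglyMeasurable]
    refine (Finset.prod_eq_zero (Finset.mem_univ s) ?_).le
    exact integral_pow_eq_zero_of_identDistrib_neg (hsymm s) (mem_oddSet.1 hs)

/-- A crude bound suffices, since the initial potential enters once and not once per layer. -/
lemma doubleFactorialProd_content_le (I : Position d → Fin n) :
    doubleFactorialProd (content I) ≤ (2 * d) ^ (2 * d) := by
  calc _ ≤ ∏ i, (2 * d) ^ content I i := by
        refine Finset.prod_le_prod' fun i _ => ?_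
        refine ((Nat.doubleFactorial_le_factorial _).trans (Nat.factorial_le_pow _)).trans ?_
        refine Nat.pow_le_pow_left ?_ _
        rw [← sum_content I]
        exact Finset.single_le_sum (f := content I) (fun _ _ => Nat.zero_le _) (Finset.mem_univ i)
    _ = _ := by rw [Finset.prod_pow_eq_pow_sum, sum_content]

lemma symVec_single_nonneg (I J : Position d → Fin n) :
    0 ≤ symVec (Pi.single I 1) J := by
  refine mul_nonneg (by positivity) (Finset.sum_nonneg fun σ _ => ?_)
  rw [Pi.single_apply]
  split_ifs <;> norm_num

lemma symVec_single_le_one (I J : Position d → Fin n) :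
    symVec (Pi.single I 1) J ≤ 1 := by
  unfold symVec
  rw [inv_mul_le_iff₀ (by exact_mod_cast Fintype.card_pos), mul_one]
  calc _ ≤ ∑ σ : Equiv.Perm (Position d), (1 : ℝ) := by
        refine Finset.sum_le_sum fun σ _ => ?_
        rw [Pi.single_apply]
        split_ifs <;> norm_num
    _ = _ := by simp

/-- Bound for the expected trace of a power of `M Mᵀ`, where `M` is the symmetrized Kronecker
power of a random matrix with independent bounded symmetric entries. -/
lemma integral_trace_le {Ω : Type*} [MeasurableSpace Ω] {μ : Measure Ω} [IsProbabilityMeasure μ]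
    {B : Ω → Matrix (Fin 2 → Fin n) (Fin 2 → Fin n) ℝ} {τ θ : ℝ} (hτ : 0 ≤ τ) (hθ : 0 < θ)
    (hind : iIndepFun (fun (s : (Fin 2 → Fin n) × (Fin 2 → Fin n)) ω => B ω s.1 s.2) μ)
    (hsymm : ∀ i j, IdentDistrib (fun ω => B ω i j) (fun ω => -B ω i j) μ μ)
    (hb : ∀ i j ω, |B ω i j| ≤ τ) {k R : ℕ} (hR : 4 * (2 * (k + 1) * d) + 2 * n + 2 ≤ R) :
    Integrable (fun ω => ((symPow (B ω) d * (symPow (B ω) d)ᵀ) ^ (k + 1)).trace) μ ∧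
    ∫ ω, ((symPow (B ω) d * (symPow (B ω) d)ᵀ) ^ (k + 1)).trace ∂μ ≤
      (n : ℝ) ^ (2 * d) * (τ ^ (2 * (k + 1) * d) * (((2 * d)! : ℝ)⁻¹ *
        (((2 * d) * R : ℝ) ^ 2 * θ + (2 * (k + 1) * d : ℕ) / θ) ^ d) ^ (2 * (k + 1)) *
          (2 * d : ℝ) ^ (2 * d)) := by
  have h (I : Position d → Fin n) := integral_walk_le (μ := μ) hτ hθ hR
    (symVec_comp (Pi.single I 1)) (symVec_single_nonneg I) (symVec_single_le_one I) (2 * (k + 1)) B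
    (fun l => integral_list_prod_le hind (fun s => hsymm s.1 s.2) (fun s => hb s.1 s.2) l) []
    (by simp [oddSet]) I
  have hcard : Fintype.card (Equiv.Perm (Position d)) = (2 * d)! := by
    rw [Fintype.card_perm]; simp [mul_comm]
  simp only [List.map_nil, List.prod_nil, one_mul, List.length_nil, zero_add, hcard] at h
  simp only [trace_pow_eq_sum_walk]
  refine ⟨integrable_finsetSum _ fun I _ => (h I).1, ?_⟩
  rw [integral_finsetSum _ fun I _ => (h I).1]
  calc _ ≤ ∑ I : Position d → Fin n, (τ ^ (2 * (k + 1) * d) * (((2 * d)! : ℝ)⁻¹ *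
        (((2 * d) * R : ℝ) ^ 2 * θ + (2 * (k + 1) * d : ℕ) / θ) ^ d) ^ (2 * (k + 1)) *
          (2 * d : ℝ) ^ (2 * d)) := by
        refine Finset.sum_le_sum fun I _ => (h I).2.trans ?_
        gcongr
        have h0 : oddSet ([] : List ((Fin 2 → Fin n) × (Fin 2 → Fin n))) = ∅ := by simp [oddSet]
        rw [h0, Finset.card_empty, pow_zero, mul_one]
        have h1 : potential (content I) 0 ∅ = doubleFactorialProd (content I) := by
          simp [potential, rowLegs, colLegs, doubleFactorialProd]
        rw [h1]
        exact_mod_cast doubleFactorialProd_content_le I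
    _ = _ := by
        rw [Finset.sum_const, Finset.card_univ, nsmul_eq_mul]
        simp [mul_comm]

lemma pow_div_three_le_factorial (m : ℕ) : ((m : ℝ) / 3) ^ m ≤ m ! := by
  rcases Nat.eq_zero_or_pos m with rfl | hm
  · simp
  refine le_trans ?_ (Stirling.le_factorial_stirling m)
  have h1 : (1 : ℝ) ≤ √(2 * Real.pi * m) := by
    rw [Real.one_le_sqrt]
    have : (1 : ℝ) ≤ m := by exact_mod_cast hm
    nlinarith [Real.pi_gt_three]
  have h2 : (m : ℝ) / 3 ≤ m / Real.exp 1 := by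
    have := Real.exp_one_lt_three
    gcongr
  calc ((m : ℝ) / 3) ^ m ≤ (m / Real.exp 1) ^ m := by gcongr
    _ ≤ _ := le_mul_of_one_le_left (by positivity) h1

lemma sq_le_three_pow {L : ℕ} (hn : 1 ≤ n) (hlog : 2 * Real.log n ≤ L) : (n : ℝ) ^ 2 ≤ 3 ^ L := by
  have hn0 : (0 : ℝ) < n := by exact_mod_cast hn
  calc (n : ℝ) ^ 2 = Real.exp (2 * Real.log n) := by
        rw [two_mul, Real.exp_add, Real.exp_log hn0, sq]
    _ ≤ Real.exp (L * 1) := by rw [mul_one]; exact Real.exp_le_exp.2 hlog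
    _ = Real.exp 1 ^ L := Real.exp_nat_mul 1 L
    _ ≤ 3 ^ L := by gcongr; exact Real.exp_one_lt_three.le

lemma trace_bound_le {L : ℕ} {τ : ℝ} (hτ : 0 ≤ τ) (hn : 1 ≤ n) (hd : 1 ≤ d) (hL : 1 ≤ L)
    (hdn : 2 * d ≤ n) (hlog : 2 * Real.log n ≤ L) {θ : ℝ}
    (hθ : θ = √(2 * L * d) / (6 * d * n)) :
    (n : ℝ) ^ (2 * d) * (τ ^ (2 * L * d) * (((2 * d)! : ℝ)⁻¹ *
        (((2 * d) * (3 * n : ℕ) : ℝ) ^ 2 * θ + (2 * L * d : ℕ) / θ) ^ d) ^ (2 * L) *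
          (2 * d : ℝ) ^ (2 * d)) ≤ (81 * τ * n * √(2 * L) / √d) ^ (2 * L * d) := by
  have hn0 : (0 : ℝ) < n := by exact_mod_cast hn
  have hd0 : (0 : ℝ) < d := by exact_mod_cast hd
  have hL0 : (0 : ℝ) < L := by exact_mod_cast hL
  have hs : 0 < √(2 * L * d) := by positivity
  have hsd : 0 < √(d : ℝ) := by positivity
  have hss : √(2 * L * d) = √(2 * L) * √d := Real.sqrt_mul (by positivity) _
  have hsq : √(2 * L * d) ^ 2 = 2 * L * d := Real.sq_sqrt (by positivity)
  -- This `θ` makes the two terms equal: `ν = 2 D R √b` with `D = 2d`, `R = 3n`, `b = 2Ld`.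
  have hν : ((2 * d) * (3 * n : ℕ) : ℝ) ^ 2 * θ + (2 * L * d : ℕ) / θ =
      12 * d * n * √(2 * L * d) := by
    have : ((2 * L * d : ℕ) : ℝ) = √(2 * L * d) ^ 2 := by rw [hsq]; push_cast; ring
    rw [this, hθ]
    push_cast
    generalize √(2 * L * d) = x at *
    field_simp
    ring
  have hγ : ((2 * d)! : ℝ)⁻¹ * (12 * d * n * √(2 * L * d)) ^ d ≤
      (27 * n * √(2 * L) / √d) ^ d := by
    have hfac : ((4 / 9 : ℝ) * d ^ 2) ^ d ≤ (2 * d)! := by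
      have h := pow_div_three_le_factorial (2 * d)
      rw [pow_mul] at h
      refine le_trans (le_of_eq ?_) h
      push_cast; ring
    rw [inv_mul_le_iff₀ (by positivity)]
    refine le_trans (le_of_eq ?_) (mul_le_mul_of_nonneg_right hfac (by positivity))
    rw [← mul_pow]
    congr 1
    rw [hss]
    have : (d : ℝ) = √d ^ 2 := (Real.sq_sqrt hd0.le).symm
    field_simp
    rw [← this]
    ring
  have hn3 := sq_le_three_pow hn hlog
  have hdn' : (2 * d : ℝ) ≤ n := by exact_mod_cast hdn
  rw [hν]
  calc _ ≤ (n : ℝ) ^ (2 * d) * (τ ^ (2 * L * d) * ((27 * n * √(2 * L) / √d) ^ d) ^ (2 * L) *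
          (n : ℝ) ^ (2 * d)) := by gcongr
    _ = ((n : ℝ) ^ 2) ^ (2 * d) * (τ * (27 * n * √(2 * L) / √d)) ^ (2 * L * d) := by
        rw [mul_pow τ, ← pow_mul (27 * n * √(2 * L) / √d), ← pow_mul, mul_comm d (2 * L)]; ring
    -- The starting points and the initial potential cost at most `n ^ (4d)`; as `n² ≤ 3 ^ L`, this
    -- is a factor `3` per entry of the walk.
    _ ≤ ((3 : ℝ) ^ L) ^ (2 * d) * (τ * (27 * n * √(2 * L) / √d)) ^ (2 * L * d) := by gcongr
    _ = (3 * (τ * (27 * n * √(2 * L) / √d))) ^ (2 * L * d) := by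
        rw [mul_pow 3, ← pow_mul 3, show L * (2 * d) = 2 * L * d by ring]
    _ = _ := by congr 1; ring

/-- Tail bound for the symmetrized Kronecker power of a random matrix with independent bounded
symmetric entries. -/
lemma measure_symPow_le {Ω : Type*} [MeasurableSpace Ω] {μ : Measure Ω} [IsProbabilityMeasure μ]
    {B : Ω → Matrix (Fin 2 → Fin n) (Fin 2 → Fin n) ℝ} {τ : ℝ} (hτ : 0 < τ)
    (hind : iIndepFun (fun (s : (Fin 2 → Fin n) × (Fin 2 → Fin n)) ω => B ω s.1 s.2) μ)
    (hsymm : ∀ i j, IdentDistrib (fun ω => B ω i j) (fun ω => -B ω i j) μ μ)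
    (hb : ∀ i j ω, |B ω i j| ≤ τ) {r : ℕ} (hn : 1 ≤ n) (hd : 1 ≤ d)
    (hR : 4 * (2 * 2 ^ (r + 1) * d) + 2 * n + 2 ≤ 3 * n)
    (hlog : 2 * Real.log n ≤ (2 ^ (r + 1) : ℕ)) :
    μ.real {ω | (243 * τ * n * √(2 * (2 ^ (r + 1) : ℕ)) / √d) ^ d ≤
      euclideanOpNorm (symPow (B ω) d)} ≤ (n : ℝ)⁻¹ := by
  have hn0 : (0 : ℝ) < n := by exact_mod_cast hn
  have hd0 : (0 : ℝ) < d := by exact_mod_cast hd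
  obtain ⟨k, hk⟩ : ∃ k, 2 ^ (r + 1) = k + 1 :=
    Nat.exists_eq_succ_of_ne_zero (pow_ne_zero _ two_ne_zero)
  have htr (ω) := euclideanOpNorm_pow_le_trace (symPow (B ω) d) r
  rw [hk] at hR hlog ⊢
  rw [hk] at htr
  set x : ℝ := 81 * τ * n * √(2 * (k + 1 : ℕ)) / √d with hx
  have hx0 : 0 < x := by positivity
  have h3x : 243 * τ * n * √(2 * (k + 1 : ℕ)) / √d = 3 * x := by rw [hx]; ring
  have hmom := integral_trace_le hτ.le (θ := √(2 * (k + 1 : ℕ) * d) / (6 * d * n)) (by positivity)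
    hind hsymm hb hR
  have hE := hmom.2.trans (trace_bound_le (L := k + 1) hτ.le hn hd (by lia) (by nlinarith) hlog rfl)
  have hmarkov := mul_meas_ge_le_integral_of_nonneg
    (Filter.Eventually.of_forall fun ω => (pow_nonneg (norm_nonneg _) _).trans (htr ω)) hmom.1
    ((3 * x) ^ (2 * (k + 1) * d))
  have hsub : {ω | (3 * x) ^ d ≤ euclideanOpNorm (symPow (B ω) d)} ⊆
      {ω | (3 * x) ^ (2 * (k + 1) * d) ≤
        ((symPow (B ω) d * (symPow (B ω) d)ᵀ) ^ (k + 1)).trace} := by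
    intro ω hω
    refine le_trans ?_ (htr ω)
    rw [mul_comm _ d, pow_mul]
    exact pow_le_pow_left₀ (by positivity) hω _
  rw [h3x]
  have hfin := (mul_le_mul_of_nonneg_left (measureReal_mono (μ := μ) hsub)
    (pow_nonneg (by positivity) (2 * (k + 1) * d))).trans (hmarkov.trans hE)
  rw [mul_pow, mul_right_comm] at hfin
  rw [← hx] at hfin
  have h1 := le_of_mul_le_mul_right (hfin.trans_eq (one_mul _).symm) (by positivity)
  -- The threshold is three times the moment bound, so Markov's inequality leaves `3 ^ (-2Ld)`,
  -- which is at most `1 / n`.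
  have h2 : (n : ℝ) ≤ 3 ^ (2 * (k + 1) * d) := by
    calc (n : ℝ) ≤ (n : ℝ) ^ 2 := le_self_pow₀ (by exact_mod_cast hn) two_ne_zero
      _ ≤ 3 ^ (k + 1) := sq_le_three_pow hn hlog
      _ ≤ _ := pow_le_pow_right₀ (by norm_num) (by nlinarith)
  rw [← one_div, le_div_iff₀ hn0, mul_comm]
  exact (mul_le_mul_of_nonneg_right h2 measureReal_nonneg).trans h1

end Tensor4

namespace Tensor4

open scoped Nat
open MeasureTheory Matrix ProbabilityTheory

variable {n d : ℕ}

/-! ### Truncation of subgaussian entries and the tail bound. -/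

/-- Truncation of a real number at level `τ`. -/
noncomputable def truncate (τ x : ℝ) : ℝ := if |x| ≤ τ then x else 0

lemma abs_truncate_le {τ : ℝ} (hτ : 0 ≤ τ) (x : ℝ) : |truncate τ x| ≤ τ := by
  unfold truncate
  split_ifs with h
  · exact h
  · simpa using hτ

lemma truncate_neg (τ x : ℝ) : truncate τ (-x) = -truncate τ x := by
  unfold truncate
  rw [abs_neg]
  split_ifs <;> simp

lemma measurable_truncate (τ : ℝ) : Measurable (truncate τ) :=
  Measurable.ite (measurableSet_le (by fun_prop) measurable_const) measurable_id measurable_const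

lemma measureReal_lt_abs_le {Ω : Type*} [MeasurableSpace Ω] {μ : Measure Ω}
    [IsProbabilityMeasure μ] {X : Ω → ℝ} {c : ℝ≥0} (h : HasSubgaussianMGF X c μ) {τ : ℝ}
    (hτ : 0 ≤ τ) : μ.real {ω | τ < |X ω|} ≤ 2 * Real.exp (-τ ^ 2 / (2 * (c + 1))) := by
  -- Raising the variance proxy to `c + 1` keeps the denominator of the exponent nonzero when `c =
  -- 0`.
  have hmono {Y : Ω → ℝ} (h : HasSubgaussianMGF Y c μ) : HasSubgaussianMGF Y (c + 1) μ :=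
    ⟨h.integrable_exp_mul, fun t => (h.mgf_le t).trans (by
      rw [Real.exp_le_exp]; push_cast; nlinarith [sq_nonneg t])⟩
  have h1 := (hmono h).measure_ge_le hτ
  have h2 := (hmono h.neg).measure_ge_le hτ
  push_cast at h1 h2
  have hsub : {ω | τ < |X ω|} ⊆ {ω | τ ≤ X ω} ∪ {ω | τ ≤ (-X) ω} := by
    intro ω hω
    rcases lt_abs.1 (show τ < |X ω| from hω) with h | h
    · exact Or.inl h.le
    · exact Or.inr h.le
  calc _ ≤ _ := measureReal_mono (μ := μ) hsub
    _ ≤ _ := measureReal_union_le _ _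
    _ ≤ _ := by rw [two_mul]; exact add_le_add h1 h2

lemma injective_vecCons_pairs :
    Function.Injective fun s : (Fin 2 → Fin n) × (Fin 2 → Fin n) =>
      ![s.1 0, s.1 1, s.2 0, s.2 1] := by
  intro s t h
  have h0 := congrFun h 0
  have h1 := congrFun h 1
  have h2 := congrFun h 2
  have h3 := congrFun h 3
  simp at h0 h1 h2 h3
  ext i <;> fin_cases i <;> simp [h0, h1, h2, h3]

/-- Tail bound for the certificate matrix of a random tensor with independent symmetric
subgaussian entries. -/
lemma measureReal_certificateMatrix_le {Ω : Type*} [MeasurableSpace Ω] {μ : Measure Ω}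
    [IsProbabilityMeasure μ] {A : (Fin 4 → Fin n) → Ω → ℝ} {c : ℝ≥0} (hind : iIndepFun A μ)
    (hsymm : ∀ s, IdentDistrib (A s) (fun ω => -A s ω) μ μ)
    (hsub : ∀ s, HasSubgaussianMGF (A s) c μ) {r : ℕ} (hn : 2 ≤ n) (hd : 1 ≤ d)
    (hR : 4 * (2 * 2 ^ (r + 1) * d) + 2 * n + 2 ≤ 3 * n)
    (hlog : 2 * Real.log n ≤ (2 ^ (r + 1) : ℕ)) :
    μ.real {ω | (243 * √(10 * (c + 1) * Real.log n) * n * √(2 * (2 ^ (r + 1) : ℕ)) / √d) ^ d ≤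
      euclideanOpNorm (certificateMatrix (fun s => A s ω) d)} ≤ 3 / n := by
  have hn0 : (0 : ℝ) < n := by exact_mod_cast (by lia : 0 < n)
  have hlog0 : 0 < Real.log n := Real.log_pos (by exact_mod_cast hn)
  set τ := √(10 * (c + 1) * Real.log n) with hτdef
  have hτ : 0 < τ := by positivity
  set B : Ω → Matrix (Fin 2 → Fin n) (Fin 2 → Fin n) ℝ := fun ω =>
    Tensor4.flatten fun s => truncate τ (A s ω) with hB
  have hindB : iIndepFun (fun (s : (Fin 2 → Fin n) × (Fin 2 → Fin n)) ω => B ω s.1 s.2) μ :=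
    (hind.precomp injective_vecCons_pairs).comp (fun _ => truncate τ)
      fun _ => measurable_truncate τ
  have hmain := measure_symPow_le hτ hindB (fun i j => by
    have h := (hsymm ![i 0, i 1, j 0, j 1]).comp (measurable_truncate τ)
    simp only [Function.comp_def, truncate_neg] at h
    exact h)
    (fun i j ω => abs_truncate_le hτ.le _) (by lia) hd hR hlog
  have hbad : μ.real (⋃ s, {ω | τ < |A s ω|}) ≤ 2 / n := by
    -- The `10` in `τ` yields the power `n ^ (-5)`, which survives a union bound over `n ^ 4`
    -- entries.
    have hexp : Real.exp (-τ ^ 2 / (2 * (c + 1))) = ((n : ℝ) ^ 5)⁻¹ := by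
      rw [hτdef, Real.sq_sqrt (by positivity), ← Real.exp_log (pow_pos hn0 5), ← Real.exp_neg,
        Real.log_pow]
      congr 1
      field_simp
      norm_num
    calc _ ≤ ∑ s, μ.real {ω | τ < |A s ω|} := measureReal_iUnion_fintype_le _
      _ ≤ ∑ s : Fin 4 → Fin n, 2 * ((n : ℝ) ^ 5)⁻¹ := by
          refine Finset.sum_le_sum fun s _ => ?_
          rw [← hexp]
          exact measureReal_lt_abs_le (hsub s) hτ.le
      _ = 2 / n := by
          rw [Finset.sum_const, Finset.card_univ, nsmul_eq_mul]
          simp only [Fintype.card_pi, Fintype.card_fin, Finset.prod_const, Finset.card_univ]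
          push_cast
          field_simp
  have hcover : {ω | (243 * τ * n * √(2 * (2 ^ (r + 1) : ℕ)) / √d) ^ d ≤
      euclideanOpNorm (certificateMatrix (fun s => A s ω) d)} ⊆
      {ω | (243 * τ * n * √(2 * (2 ^ (r + 1) : ℕ)) / √d) ^ d ≤
        euclideanOpNorm (symPow (B ω) d)} ∪ ⋃ s, {ω | τ < |A s ω|} := by
    intro ω hω
    by_cases h : ∃ s, τ < |A s ω|
    · exact Or.inr (Set.mem_iUnion.2 h)
    · left
      push Not at h
      have : (fun s => truncate τ (A s ω)) = fun s => A s ω := by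
        funext s
        simp [truncate, h s]
      simp only [Set.mem_ofPred_eq, hB, this, ← certificateMatrix_eq_symPow] at hω ⊢
      exact hω
  calc _ ≤ _ := measureReal_mono (μ := μ) hcover
    _ ≤ _ := measureReal_union_le _ _
    _ ≤ (n : ℝ)⁻¹ + 2 / n := add_le_add hmain hbad
    _ = 3 / n := by ring

/-! ### Choice of the moment and conclusion. -/

lemma exists_two_pow_between {x : ℝ} (hx : 1 ≤ x) : ∃ r : ℕ, x ≤ (2 ^ (r + 1) : ℕ) ∧
    ((2 ^ (r + 1) : ℕ) : ℝ) ≤ 2 * x := by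
  obtain ⟨r, h1, h2⟩ := exists_nat_pow_near hx one_lt_two
  refine ⟨r, by exact_mod_cast h2.le, ?_⟩
  push_cast
  rw [pow_succ]
  linarith

lemma threshold_rpow_le {x T lam : ℝ} (hd : 1 ≤ d) (hlam : 0 ≤ lam) (hx : 0 ≤ x)
    (h : x ≤ lam ^ d) (hT : lam ≤ T) : x ^ (1 / (d : ℝ)) ≤ T := by
  calc x ^ (1 / (d : ℝ)) ≤ (lam ^ d) ^ (1 / (d : ℝ)) := by gcongr
    _ = lam := by rw [one_div]; exact Real.pow_rpow_inv_natCast hlam (by lia)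
    _ ≤ T := hT

/-- Non-asymptotic form of the main theorem. -/
lemma one_sub_le_measure {Ω : Type*} [MeasurableSpace Ω] {μ : Measure Ω}
    [IsProbabilityMeasure μ] {A : (Fin 4 → Fin n) → Ω → ℝ} {c : ℝ≥0} (hind : iIndepFun A μ)
    (hsymm : ∀ s, IdentDistrib (A s) (fun ω => -A s ω) μ μ)
    (hsub : ∀ s, HasSubgaussianMGF (A s) c μ) (hn : 4 ≤ n) (hd : 1 ≤ d)
    (hdlog : (d : ℝ) * Real.log n ≤ 1 / 64 * n) :
    ENNReal.ofReal (1 - 3 / n) ≤ μ {ω |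
      euclideanOpNorm (certificateMatrix (fun s => A s ω) d) ^ (1 / (d : ℝ)) ≤
        729 * √(10 * (c + 1)) * Real.log n ^ 1 * ((n : ℝ) / (d : ℝ) ^ (1 / 2 : ℝ) *
          (d : ℝ) ^ (12 * (Real.log d / Real.log n)))} := by
  have hn0 : (0 : ℝ) < n := by exact_mod_cast (by lia : 0 < n)
  have hd1 : (1 : ℝ) ≤ d := by exact_mod_cast hd
  have hn4 : (4 : ℝ) ≤ n := by exact_mod_cast hn
  have hlog1 : 1 ≤ Real.log n := by
    rw [Real.le_log_iff_exp_le hn0]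
    linarith [Real.exp_one_lt_three]
  obtain ⟨r, hr1, hr2⟩ := exists_two_pow_between (x := 2 * Real.log n) (by linarith)
  have hR : 4 * (2 * 2 ^ (r + 1) * d) + 2 * n + 2 ≤ 3 * n := by
    -- Since `L ≤ 4 log n`, the constant `1 / 64` gives `8 L d ≤ n / 2`; the summand `2` takes the
    -- other half of the spare `n`, as `n ≥ 4`.
    have h1 : ((2 ^ (r + 1) : ℕ) : ℝ) * d ≤ 1 / 16 * n := by
      calc _ ≤ 2 * (2 * Real.log n) * d := by gcongr
        _ ≤ _ := by linarith
    have h2 : ((4 * (2 * 2 ^ (r + 1) * d) + 2 * n + 2 : ℕ) : ℝ) ≤ (3 * n : ℕ) := by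
      push_cast at h1 ⊢
      linarith
    exact_mod_cast h2
  have hmain := measureReal_certificateMatrix_le hind hsymm hsub (by lia) hd hR hr1
  set lam : ℝ := 243 * √(10 * (c + 1) * Real.log n) * n * √(2 * (2 ^ (r + 1) : ℕ)) / √d with hlam
  have hT : lam ≤ 729 * √(10 * (c + 1)) * Real.log n ^ 1 * ((n : ℝ) / (d : ℝ) ^ (1 / 2 : ℝ) *
      (d : ℝ) ^ (12 * (Real.log d / Real.log n))) := by
    -- Here `2L ≤ 8 log n ≤ 9 log n`. One `√(log n)` comes from the moment order and one from the
    -- truncation level.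
    have h1 : √(2 * (2 ^ (r + 1) : ℕ)) ≤ 3 * √(Real.log n) := by
      rw [Real.sqrt_le_left (by positivity), mul_pow, Real.sq_sqrt (by linarith)]
      linarith
    have h2 : (1 : ℝ) ≤ (d : ℝ) ^ (12 * (Real.log d / Real.log n)) := by
      refine Real.one_le_rpow hd1 ?_
      have := Real.log_nonneg hd1
      positivity
    have h3 : √(Real.log n) * √(Real.log n) = Real.log n := Real.mul_self_sqrt (by linarith)
    rw [← Real.sqrt_eq_rpow, pow_one, hlam, Real.sqrt_mul (by positivity)]
    calc _ ≤ 243 * (√(10 * (c + 1)) * √(Real.log n)) * n * (3 * √(Real.log n)) / √d := by gcongr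
      _ = 729 * √(10 * (c + 1)) * (√(Real.log n) * √(Real.log n)) * (n / √d * 1) := by ring
      _ ≤ _ := by rw [h3]; gcongr
  set G := {ω | euclideanOpNorm (certificateMatrix (fun s => A s ω) d) ^ (1 / (d : ℝ)) ≤
        729 * √(10 * (c + 1)) * Real.log n ^ 1 * ((n : ℝ) / (d : ℝ) ^ (1 / 2 : ℝ) *
          (d : ℝ) ^ (12 * (Real.log d / Real.log n)))} with hG
  have hcompl : Gᶜ ⊆ {ω | lam ^ d ≤ euclideanOpNorm (certificateMatrix (fun s => A s ω) d)} := by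
    intro ω hω
    by_contra h
    exact hω (threshold_rpow_le hd (by positivity) (norm_nonneg _) (not_le.1 h).le hT)
  have h1 : 1 ≤ μ.real G + 3 / n := by
    calc (1 : ℝ) = μ.real (G ∪ Gᶜ) := by rw [Set.union_compl_self]; simp
      _ ≤ μ.real G + μ.real Gᶜ := measureReal_union_le _ _
      _ ≤ _ := by gcongr; exact (measureReal_mono (μ := μ) hcompl).trans hmain
  rw [ENNReal.ofReal_le_iff_le_toReal (measure_ne_top μ G)]
  change _ ≤ μ.real G
  linarith

end Tensor4

theorem mainTheorem11 :
    ∃ K : ℕ, ∀ c : ℝ≥0, ∃ C : ℝ, 0 < C ∧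
      ∀ d : ℕ → ℕ, (∀ n, 1 ≤ d n) →
        Asymptotics.IsLittleO Filter.atTop
          (fun n : ℕ => (d n : ℝ) * Real.log n) (fun n : ℕ => (n : ℝ)) →
      ∀ (Ω : ℕ → Type*) [∀ n, MeasurableSpace (Ω n)]
        (P : ∀ n, MeasureTheory.Measure (Ω n)) [∀ n, MeasureTheory.IsProbabilityMeasure (P n)]
        (A : ∀ n, (Fin 4 → Fin n) → Ω n → ℝ),
        (∀ n, ProbabilityTheory.iIndepFun (A n) (P n)) →
        (∀ n s, ProbabilityTheory.IdentDistrib (A n s) (fun ω => -A n s ω) (P n) (P n)) →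
        (∀ n s, ProbabilityTheory.HasSubgaussianMGF (A n s) c (P n)) →
        Filter.Tendsto
          (fun n : ℕ => P n {ω |
            euclideanOpNorm (certificateMatrix (fun s => A n s ω) (d n)) ^ (1 / (d n : ℝ)) ≤
              C * Real.log n ^ K *
                ((n : ℝ) / (d n : ℝ) ^ (1 / 2 : ℝ) *
                  (d n : ℝ) ^ (12 * (Real.log (d n) / Real.log n)))})
          Filter.atTop (nhds 1) := by
  refine ⟨1, fun c => ⟨729 * √(10 * (c + 1)), by positivity, ?_⟩⟩
  intro d hd hdlog Ω _ P _ A hind hsymm hsub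
  have hlim : Filter.Tendsto (fun n : ℕ => ENNReal.ofReal (1 - 3 / n)) Filter.atTop (nhds 1) := by
    have h : Filter.Tendsto (fun n : ℕ => (1 : ℝ) - 3 / n) Filter.atTop (nhds (1 - 0)) :=
      tendsto_const_nhds.sub (tendsto_const_div_atTop_nhds_zero_nat 3)
    simpa [Function.comp_def] using (ENNReal.continuous_ofReal.tendsto _).comp h
  refine tendsto_of_tendsto_of_tendsto_of_le_of_le' hlim tendsto_const_nhds ?_
    (Filter.Eventually.of_forall fun n => MeasureTheory.prob_le_one)
  filter_upwards [hdlog.def (c := 1 / 64) (by norm_num), Filter.eventually_ge_atTop 4]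
    with n hdn hn
  refine Tensor4.one_sub_le_measure (hind n) (hsymm n) (hsub n) hn (hd n) ?_
  rw [Real.norm_natCast] at hdn
  exact (le_abs_self _).trans hdn
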